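/- Let $\mathbb O$ be the real normed division algebra of octonions, with identity $1$, conjugation $V\mapsto\overline V$, real part $\Re$, imaginary part $\Im(V)=V-\Re(V)1$, and inner product $\langle V,W\rangle=\Re(V\overline W)$. Let $\Im(\mathbb O)=\{V\in\mathbb O:\Re(V)=0\}$. Consider the following two real 2-step nilpotent Lie algebras: (a) $\mathfrak h(\mathbb O)=\mathbb O\oplus\Im(\mathbb O)$ (of dimension $8+7$), in which $\Im(\mathbb O)$ commutes with everything and $[U,V]=-\Im(U\overline V)\in\Im(\mathbb O)$ for $U,V\in\mathbb O$; (b) $\mathfrak n=(\mathbb O\times\mathbb O)\oplus\mathbb O$ (of dimension $16+8$), in which the last summand commutes with everything and $[(U,V),(U',V')]=UV'-U'V\in\mathbb O$ (the last summand) for $U,V,U',V'\in\mathbb O$. Each is equipped with the inner product $\langle\cdot,\cdot\rangle$ induced from that of $\mathbb O$, the two displayed summands being orthogonal and $\mathbb O\times\mathbb O$ carrying the product inner product. For a Lie algebra $\mathfrak g$ with an inner product, let $\mathfrak z$ be its center and $\mathfrak v=\mathfrak z^{\perp}$. A linear map $F:\mathfrak g\to\mathfrak g$ is skew if $\langle FX,Y\rangle=-\langle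 X,FY\rangle$ for all $X,Y$. A skew map $F$ is a closed Lorentz force if the 2-form $\omega(X,Y)=\langle FX,Y\rangle$ is closed, i.e. $d\omega(U,V,W)=-\omega([U,V],W)+\omega([U,W],V)-\omega([V,W],U)=0$ for all $U,V,W\in\mathfrak g$. The map $F$ is of type I if $F(\mathfrak v)\subseteq\mathfrak v$ and $F(\mathfrak z)\subseteq\mathfrak z$, and of type II if $F(\mathfrak v)\subseteq\mathfrak z$ and $F(\mathfrak z)\subseteq\mathfrak v$. It satisfies condition (C2) if $$\langle F_{\mathfrak z}(U),[V,W]\rangle+\langle F_{\mathfrak z}(V),[W,U]\rangle+\langle F_{\mathfrak z}(W),[U,V]\rangle=0\qquad\text{for all }U,V,W\in\mathfrak v,$$ where $F_{\mathfrak z}$ is $F$ followed by the orthogonal projection onto $\mathfrak z$. **Proposition.** On each of the Lie algebras $\mathfrak h(\mathbb O)$ and $(\mathbb O\times\mathbb O)\oplus\mathbb O$, every closed Lorentz force is of type I. Equivalently, on each of them there is no nonzero skew map of type II satisfying condition (C2). -/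

import Mathlib

open scoped Quaternion

noncomputable section

namespace HTypeForce

/-! ### Octonions -/

/-- The real algebra of octonions, as pairs of real quaternions (Cayley-Dickson doubling). -/
@[ext]
structure Octonion : Type where
  /-- the first quaternionic component -/
  fst : ℍ[ℝ]
  /-- the second quaternionic component -/
  snd : ℍ[ℝ]

namespace Octonion

/-- The underlying pair of quaternions; the vector space structure is transported along it. -/
def equivProd : Octonion ≃ ℍ[ℝ] × ℍ[ℝ] where
  toFun x := (x.fst, x.snd)
  invFun p := ⟨p.1, p.2⟩

instance : AddCommGroup Octonion := equivProd.addCommGroup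
instance : Module ℝ Octonion := equivProd.module ℝ
instance : Module.Finite ℝ Octonion := Module.Finite.equiv (equivProd.linearEquiv ℝ).symm

@[simp] theorem add_fst (x y : Octonion) : (x + y).1 = x.1 + y.1 := rfl
@[simp] theorem add_snd (x y : Octonion) : (x + y).2 = x.2 + y.2 := rfl
@[simp] theorem smul_fst (r : ℝ) (x : Octonion) : (r • x).1 = r • x.1 := rfl
@[simp] theorem smul_snd (r : ℝ) (x : Octonion) : (r • x).2 = r • x.2 := rfl
@[simp] theorem zero_fst : (0 : Octonion).1 = 0 := rfl
@[simp] theorem zero_snd : (0 : Octonion).2 = 0 := rfl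

/-- The identity element. -/
instance : One Octonion := ⟨mk 1 0⟩

@[simp] theorem one_fst : (1 : Octonion).1 = 1 := rfl
@[simp] theorem one_snd : (1 : Octonion).2 = 0 := rfl

/-- The octonion product, as a bilinear map:
`(a, b) (c, d) = (a c - d̄ b, d a + b c̄)`. -/
def mulBilin : Octonion →ₗ[ℝ] Octonion →ₗ[ℝ] Octonion :=
  LinearMap.mk₂ ℝ (fun x y => mk (x.1 * y.1 - star y.2 * x.2) (y.2 * x.1 + x.2 * star y.1))
    (fun x x' y => by
      apply Octonion.ext <;> simp only [add_fst, add_snd] <;> noncomm_ring)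
    (fun r x y => by
      apply Octonion.ext <;> simp [smul_sub])
    (fun x y y' => by
      apply Octonion.ext <;> simp only [add_fst, add_snd, star_add] <;> noncomm_ring)
    (fun r x y => by
      apply Octonion.ext <;> simp [smul_sub])

instance : Mul Octonion := ⟨fun x y => mulBilin x y⟩

theorem mul_fst (x y : Octonion) : (x * y).1 = x.1 * y.1 - star y.2 * x.2 := rfl
theorem mul_snd (x y : Octonion) : (x * y).2 = y.2 * x.1 + x.2 * star y.1 := rfl

/-- Octonion conjugation `(a, b) ↦ (ā, -b)`. -/
def conj : Octonion →ₗ[ℝ] Octonion where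
  toFun x := mk (star x.1) (-x.2)
  map_add' x y := by apply Octonion.ext <;> simp [add_comm]
  map_smul' r x := by apply Octonion.ext <;> simp

theorem conj_fst (x : Octonion) : (conj x).1 = star x.1 := rfl
theorem conj_snd (x : Octonion) : (conj x).2 = -x.2 := rfl

/-- The real part of an octonion. -/
def re : Octonion →ₗ[ℝ] ℝ where
  toFun x := x.1.re
  map_add' _ _ := rfl
  map_smul' _ _ := rfl

theorem re_apply (x : Octonion) : re x = x.1.re := rfl

/-- The space `Im(𝕆)` of purely imaginary octonions. -/
def Im : Submodule ℝ Octonion := LinearMap.ker re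

/-- The imaginary part `V ↦ V - Re(V) 1`, with values in `Im(𝕆)`. -/
def im : Octonion →ₗ[ℝ] Im :=
  LinearMap.codRestrict Im (LinearMap.id - re.smulRight (1 : Octonion)) (fun x => by
    simp only [Im, LinearMap.mem_ker, LinearMap.sub_apply, LinearMap.id_apply,
      LinearMap.smulRight_apply, map_sub, map_smul]
    simp [re_apply])

theorem coe_im (x : Octonion) : (im x : Octonion) = x - re x • (1 : Octonion) := rfl

/-- The bilinear form `⟨V, W⟩ = Re(V W̄)`. -/
def form : LinearMap.BilinForm ℝ Octonion := (mulBilin.compl₂ conj).compr₂ re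

theorem form_apply (x y : Octonion) : form x y = re (x * conj y) := rfl

theorem form_eq (x y : Octonion) :
    form x y = (x.1 * star y.1).re + (star y.2 * x.2).re := by
  simp [form_apply, re_apply, mul_fst, conj_fst, conj_snd]

end Octonion

/-! ### Inner products -/

/-- An inner product on a real vector space. -/
structure Metric (E : Type*) [AddCommGroup E] [Module ℝ E] where
  /-- the underlying bilinear form -/
  form : LinearMap.BilinForm ℝ E
  symm : ∀ x y, form x y = form y x
  pos : ∀ x, x ≠ 0 → 0 < form x x

namespace Metric

variable {E E' : Type*} [AddCommGroup E] [Module ℝ E] [AddCommGroup E'] [Module ℝ E']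

/-- The restriction of an inner product to a subspace. -/
def restrict (g : Metric E) (K : Submodule ℝ E) : Metric K where
  form := g.form.restrict K
  symm x y := g.symm x y
  pos x hx := g.pos x (by simpa using hx)

/-- The product inner product `⟨(v, z), (v', z')⟩ = ⟨v, v'⟩ + ⟨z, z'⟩`. -/
def prod (g : Metric E) (g' : Metric E') : Metric (E × E') where
  form := g.form.compl₁₂ (LinearMap.fst ℝ E E') (LinearMap.fst ℝ E E')
    + g'.form.compl₁₂ (LinearMap.snd ℝ E E') (LinearMap.snd ℝ E E')
  symm x y := by simp [g.symm x.1, g'.symm x.2]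
  pos x hx := by
    have h (a : E) : 0 ≤ g.form a a := by
      by_cases ha : a = 0
      · simp [ha]
      · exact (g.pos a ha).le
    have h' (a : E') : 0 ≤ g'.form a a := by
      by_cases ha : a = 0
      · simp [ha]
      · exact (g'.pos a ha).le
    simp only [LinearMap.add_apply, LinearMap.compl₁₂_apply, LinearMap.fst_apply,
      LinearMap.snd_apply]
    by_cases h1 : x.1 = 0
    · have h2 : x.2 ≠ 0 := fun h2 => hx (Prod.ext h1 h2)
      linarith [h x.1, g'.pos x.2 h2]
    · linarith [g.pos x.1 h1, h' x.2]

/-- The pull-back of an inner product along a linear isomorphism. -/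
def comap (g : Metric E') (e : E ≃ₗ[ℝ] E') : Metric E where
  form := g.form.compl₁₂ e.toLinearMap e.toLinearMap
  symm x y := g.symm (e x) (e y)
  pos x hx := g.pos (e x) (by simpa using hx)

/-- A subspace and its orthogonal complement are complementary. -/
theorem isCompl_orthogonal [Module.Finite ℝ E] (g : Metric E) (K : Submodule ℝ E) :
    IsCompl K (g.form.orthogonal K) := by
  have hr : g.form.IsRefl := fun x y h => by rw [g.symm, h]
  refine LinearMap.BilinForm.isCompl_orthogonal_of_restrict_nondegenerate hr ?_
  have key : ∀ x : K, (g.restrict K).form x x = 0 → x = 0 := fun x hx => by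
    by_contra hne
    exact ((g.restrict K).pos x hne).ne' hx
  exact ⟨fun x hx => key x (hx x), fun x hx => key x (hx x)⟩

end Metric

/-- The standard inner product `⟨V, W⟩ = Re(V W̄)` of the octonions. -/
def Octonion.metric : Metric Octonion where
  form := Octonion.form
  symm x y := by
    simp only [Octonion.form_eq, Quaternion.re_mul, Quaternion.re_star, Quaternion.imI_star,
      Quaternion.imJ_star, Quaternion.imK_star]
    ring
  pos x hx := by
    have h1 : Octonion.form x x = Quaternion.normSq x.1 + Quaternion.normSq x.2 := by
      simp only [Octonion.form_eq, Quaternion.re_mul, Quaternion.re_star, Quaternion.imI_star,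
        Quaternion.imJ_star, Quaternion.imK_star, Quaternion.normSq_def']
      ring
    rw [h1]
    have ha := Quaternion.normSq_nonneg (a := x.1)
    have hb := Quaternion.normSq_nonneg (a := x.2)
    refine lt_of_le_of_ne (add_nonneg ha hb) fun h => hx ?_
    exact Octonion.ext (Quaternion.normSq_eq_zero.1 (by linarith))
      (Quaternion.normSq_eq_zero.1 (by linarith))

/-! ### Lorentz forces on a Lie algebra with an inner product -/

section General

variable {n : Type*} [LieRing n] [LieAlgebra ℝ n]

/-- The center `𝔷` of the Lie algebra, as a subspace. -/
def centerSpace (n : Type*) [LieRing n] [LieAlgebra ℝ n] : Submodule ℝ n :=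
  (LieAlgebra.center ℝ n).toSubmodule

/-- The orthogonal complement `𝔳 = 𝔷^⊥` of the center. -/
def vSpace (g : Metric n) : Submodule ℝ n := g.form.orthogonal (centerSpace n)

/-- The orthogonal projection of `𝔫 = 𝔳 ⊕ 𝔷` onto the center `𝔷`. -/
def centerProj [Module.Finite ℝ n] (g : Metric n) : n →ₗ[ℝ] n :=
  (centerSpace n).projection (vSpace g) (g.isCompl_orthogonal (centerSpace n))

/-- `F` is skew-symmetric: `⟨F X, Y⟩ = -⟨X, F Y⟩`. -/
def IsSkew (g : Metric n) (F : n →ₗ[ℝ] n) : Prop :=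
  ∀ X Y, g.form (F X) Y = -g.form X (F Y)

/-- The bilinear form `ω(X, Y) = ⟨F X, Y⟩`; it is a 2-form when `F` is skew-symmetric. -/
def assocForm (g : Metric n) (F : n →ₗ[ℝ] n) : LinearMap.BilinForm ℝ n := g.form.compLeft F

/-- The exterior derivative of a left-invariant 2-form:
`dω(U, V, W) = -ω([U, V], W) + ω([U, W], V) - ω([V, W], U)`. -/
def extDeriv₂ (ω : LinearMap.BilinForm ℝ n) (U V W : n) : ℝ :=
  -ω ⁅U, V⁆ W + ω ⁅U, W⁆ V - ω ⁅V, W⁆ U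

/-- `F` is a closed Lorentz force: a skew-symmetric map whose 2-form `⟨F ·, ·⟩` is closed. -/
def IsClosedLorentzForce (g : Metric n) (F : n →ₗ[ℝ] n) : Prop :=
  IsSkew g F ∧ ∀ U V W, extDeriv₂ (assocForm g F) U V W = 0

/-- Type I: `F` preserves the decomposition `𝔫 = 𝔳 ⊕ 𝔷`. -/
def IsTypeI (g : Metric n) (F : n →ₗ[ℝ] n) : Prop :=
  (∀ V ∈ vSpace g, F V ∈ vSpace g) ∧ ∀ Z ∈ centerSpace n, F Z ∈ centerSpace n

/-- Type II: `F(𝔳) ⊆ 𝔷` and `F(𝔷) ⊆ 𝔳`. -/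
def IsTypeII (g : Metric n) (F : n →ₗ[ℝ] n) : Prop :=
  (∀ V ∈ vSpace g, F V ∈ centerSpace n) ∧ ∀ Z ∈ centerSpace n, F Z ∈ vSpace g

/-- Condition (C2): with `F_𝔷` the component of `F` in the center,
`⟨F_𝔷 U, [V, W]⟩ + ⟨F_𝔷 V, [W, U]⟩ + ⟨F_𝔷 W, [U, V]⟩ = 0` for all `U, V, W ∈ 𝔳`. -/
def CondC2 [Module.Finite ℝ n] (g : Metric n) (F : n →ₗ[ℝ] n) : Prop :=
  ∀ U ∈ vSpace g, ∀ V ∈ vSpace g, ∀ W ∈ vSpace g,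
    g.form (centerProj g (F U)) ⁅V, W⁆ + g.form (centerProj g (F V)) ⁅W, U⁆
      + g.form (centerProj g (F W)) ⁅U, V⁆ = 0

end General

/-! ### Two-step nilpotent Lie algebras from alternating maps -/

section TwoStep

variable {V Z : Type*} [AddCommGroup V] [Module ℝ V] [AddCommGroup Z] [Module ℝ Z]

/-- The vector space `V ⊕ Z` with the Lie bracket `[(v, z), (v', z')] = (0, β(v, v'))`,
for an alternating bilinear map `β : V × V → Z`. -/
@[ext]
structure TwoStep (β : V →ₗ[ℝ] V →ₗ[ℝ] Z) (hβ : β.IsAlt) where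
  /-- the component in `V` -/
  fst : V
  /-- the component in `Z` -/
  snd : Z

variable {β : V →ₗ[ℝ] V →ₗ[ℝ] Z} {hβ : β.IsAlt}

/-- The underlying pair; the vector space structure is transported along it. -/
def TwoStep.equivProd (β : V →ₗ[ℝ] V →ₗ[ℝ] Z) (hβ : β.IsAlt) : TwoStep β hβ ≃ V × Z where
  toFun x := (x.fst, x.snd)
  invFun p := ⟨p.1, p.2⟩

instance : AddCommGroup (TwoStep β hβ) := (TwoStep.equivProd β hβ).addCommGroup
instance : Module ℝ (TwoStep β hβ) := (TwoStep.equivProd β hβ).module ℝ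
instance [Module.Finite ℝ V] [Module.Finite ℝ Z] : Module.Finite ℝ (TwoStep β hβ) :=
  Module.Finite.equiv ((TwoStep.equivProd β hβ).linearEquiv ℝ).symm

instance : Bracket (TwoStep β hβ) (TwoStep β hβ) :=
  ⟨fun x y => ⟨0, β x.1 y.1⟩⟩

theorem TwoStep.lie_fst (x y : TwoStep β hβ) : ⁅x, y⁆.1 = 0 := rfl
theorem TwoStep.lie_snd (x y : TwoStep β hβ) : ⁅x, y⁆.2 = β x.1 y.1 := rfl
theorem TwoStep.add_fst (x y : TwoStep β hβ) : (x + y).1 = x.1 + y.1 := rfl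
theorem TwoStep.add_snd (x y : TwoStep β hβ) : (x + y).2 = x.2 + y.2 := rfl
theorem TwoStep.smul_fst (r : ℝ) (x : TwoStep β hβ) : (r • x).1 = r • x.1 := rfl
theorem TwoStep.smul_snd (r : ℝ) (x : TwoStep β hβ) : (r • x).2 = r • x.2 := rfl
theorem TwoStep.zero_fst : (0 : TwoStep β hβ).1 = 0 := rfl
theorem TwoStep.zero_snd : (0 : TwoStep β hβ).2 = 0 := rfl

instance : LieRing (TwoStep β hβ) where
  add_lie x y z := by
    apply TwoStep.ext <;> simp [TwoStep.lie_fst, TwoStep.lie_snd, TwoStep.add_fst, TwoStep.add_snd]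
  lie_add x y z := by
    apply TwoStep.ext <;> simp [TwoStep.lie_fst, TwoStep.lie_snd, TwoStep.add_fst, TwoStep.add_snd]
  lie_self x := by
    apply TwoStep.ext
    · rfl
    · exact hβ x.1
  leibniz_lie x y z := by
    apply TwoStep.ext <;> simp [TwoStep.lie_fst, TwoStep.lie_snd, TwoStep.add_fst, TwoStep.add_snd]

instance : LieAlgebra ℝ (TwoStep β hβ) where
  lie_smul r x y := by
    apply TwoStep.ext <;>
      simp [TwoStep.lie_fst, TwoStep.lie_snd, TwoStep.smul_fst, TwoStep.smul_snd]

/-- The inner product on `V ⊕ Z` for which `V` and `Z` are orthogonal. -/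
def TwoStep.metric (β : V →ₗ[ℝ] V →ₗ[ℝ] Z) (hβ : β.IsAlt) (g : Metric V) (g' : Metric Z) :
    Metric (TwoStep β hβ) :=
  (g.prod g').comap ((TwoStep.equivProd β hβ).linearEquiv ℝ)

end TwoStep

/-! ### The two octonionic algebras -/

/-- The bracket `[U, V] = -Im(U V̄)` on `𝕆`. -/
def heisBracket : Octonion →ₗ[ℝ] Octonion →ₗ[ℝ] Octonion.Im :=
  -((Octonion.mulBilin.compl₂ Octonion.conj).compr₂ Octonion.im)

theorem heisBracket_apply (U V : Octonion) :
    heisBracket U V = -Octonion.im (U * Octonion.conj V) := rfl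

theorem heisBracket_isAlt : heisBracket.IsAlt := fun U => by
  rw [heisBracket_apply, neg_eq_zero]
  apply Subtype.ext
  rw [Octonion.coe_im]
  apply Octonion.ext
  · change (U * Octonion.conj U).1 - _ • (1 : ℍ[ℝ]) = 0
    simp only [Octonion.re_apply, Octonion.mul_fst, Octonion.conj_fst, Octonion.conj_snd]
    ext <;> simp <;> ring
  · change (U * Octonion.conj U).2 - _ • (0 : ℍ[ℝ]) = 0
    simp [Octonion.mul_snd, Octonion.conj_fst, Octonion.conj_snd]

/-- The octonionic Heisenberg algebra `𝔥(𝕆) = 𝕆 ⊕ Im(𝕆)`. -/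
abbrev OctHeis : Type := TwoStep heisBracket heisBracket_isAlt

/-- The inner product of `𝔥(𝕆)` induced from `𝕆`. -/
def OctHeis.metric : Metric OctHeis :=
  TwoStep.metric heisBracket heisBracket_isAlt Octonion.metric
    (Octonion.metric.restrict Octonion.Im)

/-- The bracket `[(U, V), (U', V')] = U V' - U' V` on `𝕆 × 𝕆`. -/
def doubleBracket : (Octonion × Octonion) →ₗ[ℝ] (Octonion × Octonion) →ₗ[ℝ] Octonion :=
  Octonion.mulBilin.compl₁₂ (LinearMap.fst ℝ Octonion Octonion) (LinearMap.snd ℝ Octonion Octonion)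
    - (Octonion.mulBilin.compl₁₂ (LinearMap.fst ℝ Octonion Octonion)
        (LinearMap.snd ℝ Octonion Octonion)).flip

theorem doubleBracket_apply (X Y : Octonion × Octonion) :
    doubleBracket X Y = X.1 * Y.2 - Y.1 * X.2 := rfl

theorem doubleBracket_isAlt : doubleBracket.IsAlt := fun X => by
  rw [doubleBracket_apply, sub_self]

/-- The Lie algebra `(𝕆 × 𝕆) ⊕ 𝕆`. -/
abbrev OctDouble : Type := TwoStep doubleBracket doubleBracket_isAlt

/-- The inner product of `(𝕆 × 𝕆) ⊕ 𝕆` induced from `𝕆`. -/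
def OctDouble.metric : Metric OctDouble :=
  TwoStep.metric doubleBracket doubleBracket_isAlt (Octonion.metric.prod Octonion.metric)
    Octonion.metric

end HTypeForce

end

/-!
On a two-step algebra `V ⊕ Z` whose bracket `β` is nondegenerate, the center is `Z` and its
orthogonal complement is `V`. For a skew map `F` with components `T : V → Z` and `Z → V`, the
second one is `-Tᵗ`, so `F` is of type I exactly when `T = 0`. On triples of `V`, closedness of
`⟨F ·, ·⟩` and condition (C2) both become the cyclic identity
`⟨T u, β v w⟩ + ⟨T v, β w u⟩ + ⟨T w, β u v⟩ = 0`. Both claims thus follow once the cyclic identity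
is known to force `T = 0` (`isTypeI_of_isClosedLorentzForce`, `eq_zero_of_isTypeII_of_condC2`).

For `𝔥(𝕆)` (`heisBracket_eq_zero_of_cyclicIdentity`): fix a basis octonion `U` and put
`x i = ⟨T (eᵢ U), eᵢ⟩` for the seven imaginary units `eᵢ`. If `a, b, c` is a line of the Fano plane,
then `(e_b U) conj(e_c U) = ± e_a`, with a sign that does not change under cyclic rotation of the
line, so the cyclic identity at `e_a U, e_b U, e_c U` reads `x a + x b + x c = 0`. The incidence
matrix of the Fano plane is invertible, hence `x = 0`. By linearity `⟨T (eᵢ U), eᵢ⟩ = 0` for every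
octonion `U`, and `U = conj(eᵢ) X` gives `⟨T X, eᵢ⟩ = 0` for all `X` and `i`.

For `(𝕆 × 𝕆) ⊕ 𝕆` (`doubleBracket_eq_zero_of_cyclicIdentity`): the bracket vanishes on each factor
of `𝕆 × 𝕆`, so the component `A` of `T` on the first factor satisfies
`conj(v) (A u) = conj(u) (A v)`. Hence `A u = conj(u) a` with `a = A 1`, and the left
multiplications by `i` and `j` commute on `a`; since they anticommute and are invertible, `a = 0`.
The second factor is the mirror image.
-/

open scoped Quaternion

noncomputable section

namespace HTypeForce

namespace Metric

variable {E : Type*} [AddCommGroup E] [Module ℝ E]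

theorem eq_zero_of_forall_form_eq_zero (g : Metric E) {x : E} (h : ∀ y, g.form x y = 0) :
    x = 0 := by
  by_contra hx
  exact (g.pos x hx).ne' (h x)

end Metric

/-! ### Skew maps on two-step algebras -/

section TwoStep

variable {V Z : Type*} [AddCommGroup V] [Module ℝ V] [AddCommGroup Z] [Module ℝ Z]
  {β : V →ₗ[ℝ] V →ₗ[ℝ] Z} {hβ : β.IsAlt} {g : Metric V} {g' : Metric Z}

theorem TwoStep.metric_form (x y : TwoStep β hβ) :
    (TwoStep.metric β hβ g g').form x y = g.form x.1 y.1 + g'.form x.2 y.2 := rfl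

theorem TwoStep.mem_centerSpace (hnd : ∀ v, (∀ w, β v w = 0) → v = 0) {x : TwoStep β hβ} :
    x ∈ centerSpace (TwoStep β hβ) ↔ x.1 = 0 := by
  change x ∈ LieAlgebra.center ℝ (TwoStep β hβ) ↔ x.1 = 0
  rw [LieModule.mem_maxTrivSubmodule]
  constructor
  · refine fun h => hnd _ fun w => ?_
    have := congrArg TwoStep.snd (h ⟨w, 0⟩)
    rw [TwoStep.lie_snd, TwoStep.zero_snd] at this
    rw [← hβ.neg, this, neg_zero]
  · intro h y
    apply TwoStep.ext
    · rfl
    · rw [TwoStep.lie_snd, h, map_zero, TwoStep.zero_snd]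

theorem TwoStep.mem_vSpace (hnd : ∀ v, (∀ w, β v w = 0) → v = 0) {x : TwoStep β hβ} :
    x ∈ vSpace (TwoStep.metric β hβ g g') ↔ x.2 = 0 := by
  rw [vSpace, LinearMap.BilinForm.mem_orthogonal_iff]
  constructor
  · intro h
    refine g'.eq_zero_of_forall_form_eq_zero fun z => ?_
    rw [g'.symm]
    have := h ⟨0, z⟩ ((TwoStep.mem_centerSpace hnd).2 rfl)
    change (TwoStep.metric β hβ g g').form _ _ = 0 at this
    rw [TwoStep.metric_form] at this
    simpa using this
  · intro h y hy
    rw [TwoStep.mem_centerSpace hnd] at hy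
    change (TwoStep.metric β hβ g g').form _ _ = 0
    rw [TwoStep.metric_form, h, hy]
    simp

/-- The component `V → Z` of an endomorphism of `V ⊕ Z`. -/
def TwoStep.vToZ (F : TwoStep β hβ →ₗ[ℝ] TwoStep β hβ) : V →ₗ[ℝ] Z where
  toFun v := (F ⟨v, 0⟩).2
  map_add' v w := by
    rw [← TwoStep.add_snd, ← map_add]
    congr 2
    apply TwoStep.ext
    · rfl
    · simp [TwoStep.add_snd]
  map_smul' r v := by
    rw [RingHom.id_apply, ← TwoStep.smul_snd, ← map_smul]
    congr 2
    apply TwoStep.ext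
    · rfl
    · simp [TwoStep.smul_snd]

theorem TwoStep.vToZ_apply {F : TwoStep β hβ →ₗ[ℝ] TwoStep β hβ} {x : TwoStep β hβ}
    (hx : x.2 = 0) : (F x).2 = TwoStep.vToZ F x.1 :=
  congrArg (fun y => (F y).2) (TwoStep.ext rfl hx)

/-- The cyclic identity of condition (C2), for a linear map `T : V → Z`. -/
def CyclicIdentity (β : V →ₗ[ℝ] V →ₗ[ℝ] Z) (g' : Metric Z) (T : V →ₗ[ℝ] Z) : Prop :=
  ∀ u v w, g'.form (T u) (β v w) + g'.form (T v) (β w u) + g'.form (T w) (β u v) = 0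

/-- By skewness, the component `Z → V` of `F` is minus the adjoint of its component `V → Z`, so
both vanish together. -/
theorem IsSkew.fst_eq_zero {F : TwoStep β hβ →ₗ[ℝ] TwoStep β hβ}
    (hF : IsSkew (TwoStep.metric β hβ g g') F) (hT : TwoStep.vToZ F = 0) {x : TwoStep β hβ}
    (hx : x.1 = 0) : (F x).1 = 0 := by
  refine g.eq_zero_of_forall_form_eq_zero fun v => ?_
  have h := hF x ⟨v, 0⟩
  rw [TwoStep.metric_form, TwoStep.metric_form, TwoStep.vToZ_apply (x := ⟨v, 0⟩) rfl, hx, hT] at h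
  simpa using h

/-- On three vectors of `V`, closedness of `⟨F ·, ·⟩` is the cyclic identity. -/
theorem IsClosedLorentzForce.cyclicIdentity {F : TwoStep β hβ →ₗ[ℝ] TwoStep β hβ}
    (hF : IsClosedLorentzForce (TwoStep.metric β hβ g g') F) :
    CyclicIdentity β g' (TwoStep.vToZ F) := by
  intro u v w
  have key (a b c : V) : assocForm (TwoStep.metric β hβ g g') F ⁅(⟨a, 0⟩ : TwoStep β hβ),
      (⟨b, 0⟩ : TwoStep β hβ)⁆ ⟨c, 0⟩ = - g'.form (TwoStep.vToZ F c) (β a b) := by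
    have h := hF.1 ⁅(⟨a, 0⟩ : TwoStep β hβ), (⟨b, 0⟩ : TwoStep β hβ)⁆ ⟨c, 0⟩
    rw [(TwoStep.metric β hβ g g').symm _ (F _), TwoStep.metric_form _ ⁅_, _⁆, TwoStep.lie_fst,
      TwoStep.lie_snd, map_zero, zero_add] at h
    exact h
  have h := hF.2 ⟨u, 0⟩ ⟨v, 0⟩ ⟨w, 0⟩
  rw [extDeriv₂, key, key, key, ← hβ.neg w u, map_neg] at h
  linarith

theorem CondC2.cyclicIdentity [Module.Finite ℝ V] [Module.Finite ℝ Z]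
    {F : TwoStep β hβ →ₗ[ℝ] TwoStep β hβ} (hnd : ∀ v, (∀ w, β v w = 0) → v = 0)
    (hII : IsTypeII (TwoStep.metric β hβ g g') F) (hC : CondC2 (TwoStep.metric β hβ g g') F) :
    CyclicIdentity β g' (TwoStep.vToZ F) := by
  intro u v w
  have mem (a : V) : (⟨a, 0⟩ : TwoStep β hβ) ∈ vSpace (TwoStep.metric β hβ g g') :=
    (TwoStep.mem_vSpace hnd).2 rfl
  have key (a b c : V) : (TwoStep.metric β hβ g g').form
      (centerProj (TwoStep.metric β hβ g g') (F ⟨a, 0⟩))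
      ⁅(⟨b, 0⟩ : TwoStep β hβ), (⟨c, 0⟩ : TwoStep β hβ)⁆ =
      g'.form (TwoStep.vToZ F a) (β b c) := by
    have hp : centerProj (TwoStep.metric β hβ g g') (F ⟨a, 0⟩) = F ⟨a, 0⟩ :=
      Submodule.projection_apply_left _ ⟨F ⟨a, 0⟩, hII.1 _ (mem a)⟩
    rw [hp, TwoStep.metric_form, TwoStep.lie_fst, TwoStep.lie_snd, map_zero, zero_add]
    rfl
  have h := hC _ (mem u) _ (mem v) _ (mem w)
  rwa [key, key, key] at h

/-- If only the zero map satisfies the cyclic identity, every closed Lorentz force is of type I. -/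
theorem isTypeI_of_isClosedLorentzForce (hnd : ∀ v, (∀ w, β v w = 0) → v = 0)
    (hT : ∀ T, CyclicIdentity β g' T → T = 0) {F : TwoStep β hβ →ₗ[ℝ] TwoStep β hβ}
    (hF : IsClosedLorentzForce (TwoStep.metric β hβ g g') F) :
    IsTypeI (TwoStep.metric β hβ g g') F := by
  have h0 := hT _ hF.cyclicIdentity
  constructor
  · intro x hx
    rw [TwoStep.mem_vSpace hnd] at hx ⊢
    rw [TwoStep.vToZ_apply hx, h0, LinearMap.zero_apply]
  · intro x hx
    rw [TwoStep.mem_centerSpace hnd] at hx ⊢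
    exact hF.1.fst_eq_zero h0 hx

/-- If only the zero map satisfies the cyclic identity, there is no nonzero skew map of type II
satisfying (C2). -/
theorem eq_zero_of_isTypeII_of_condC2 [Module.Finite ℝ V] [Module.Finite ℝ Z]
    (hnd : ∀ v, (∀ w, β v w = 0) → v = 0)
    (hT : ∀ T, CyclicIdentity β g' T → T = 0) {F : TwoStep β hβ →ₗ[ℝ] TwoStep β hβ}
    (hF : IsSkew (TwoStep.metric β hβ g g') F) (hII : IsTypeII (TwoStep.metric β hβ g g') F)
    (hC : CondC2 (TwoStep.metric β hβ g g') F) : F = 0 := by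
  have h0 := hT _ (hC.cyclicIdentity hnd hII)
  have hv (v : V) : F ⟨v, 0⟩ = 0 := by
    apply TwoStep.ext
    · exact (TwoStep.mem_centerSpace hnd).1 (hII.1 _ ((TwoStep.mem_vSpace hnd).2 rfl))
    · rw [TwoStep.vToZ_apply rfl, h0]; rfl
  have hz (z : Z) : F ⟨0, z⟩ = 0 := by
    apply TwoStep.ext
    · exact hF.fst_eq_zero h0 rfl
    · exact (TwoStep.mem_vSpace hnd).1 (hII.2 _ ((TwoStep.mem_centerSpace hnd).2 rfl))
  ext1 x
  have hx : x = ⟨x.1, 0⟩ + ⟨0, x.2⟩ := by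
    apply TwoStep.ext
    · simp [TwoStep.add_fst]
    · simp [TwoStep.add_snd]
  rw [hx, map_add, hv, hz, add_zero, LinearMap.zero_apply]

end TwoStep

/-! ### Octonion algebra -/

namespace Octonion

/-- The adjoint of left multiplication by `y` is left multiplication by `conj y`. -/
theorem form_mul_right (x y z : Octonion) : form x (y * z) = form (conj y * x) z := by
  simp only [form_eq, mul_fst, mul_snd, conj_fst, conj_snd, Quaternion.re_mul, Quaternion.imI_mul,
    Quaternion.imJ_mul, Quaternion.imK_mul, Quaternion.re_star, Quaternion.imI_star,
    Quaternion.imJ_star, Quaternion.imK_star, Quaternion.re_add, Quaternion.imI_add,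
    Quaternion.imJ_add, Quaternion.imK_add, Quaternion.re_sub, Quaternion.imI_sub,
    Quaternion.imJ_sub, Quaternion.imK_sub, Quaternion.re_neg, Quaternion.imI_neg,
    Quaternion.imJ_neg, Quaternion.imK_neg]
  ring

/-- The adjoint of right multiplication by `z` is right multiplication by `conj z`. -/
theorem form_mul_left (x y z : Octonion) : form x (y * z) = form (x * conj z) y := by
  simp only [form_eq, mul_fst, mul_snd, conj_fst, conj_snd, Quaternion.re_mul, Quaternion.imI_mul,
    Quaternion.imJ_mul, Quaternion.imK_mul, Quaternion.re_star, Quaternion.imI_star,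
    Quaternion.imJ_star, Quaternion.imK_star, Quaternion.re_add, Quaternion.imI_add,
    Quaternion.imJ_add, Quaternion.imK_add, Quaternion.re_sub, Quaternion.imI_sub,
    Quaternion.imJ_sub, Quaternion.imK_sub, Quaternion.re_neg, Quaternion.imI_neg,
    Quaternion.imJ_neg, Quaternion.imK_neg]
  ring

instance : MulZeroOneClass Octonion where
  one_mul x := by apply Octonion.ext <;> simp [mul_fst, mul_snd]
  mul_one x := by apply Octonion.ext <;> simp [mul_fst, mul_snd]
  zero_mul x := by apply Octonion.ext <;> simp [mul_fst, mul_snd]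
  mul_zero x := by apply Octonion.ext <;> simp [mul_fst, mul_snd]

theorem conj_one : conj 1 = 1 := by
  apply Octonion.ext <;> simp [conj_fst, conj_snd]

theorem mk_mul_mk (a b c d : ℍ[ℝ]) :
    mk a b * mk c d = mk (a * c - star d * b) (d * a + b * star c) := rfl

theorem conj_mk (a b : ℍ[ℝ]) : conj (mk a b) = mk (star a) (-b) := rfl

/-- The quaternion unit `i`. -/
def qI : ℍ[ℝ] := ⟨0, 1, 0, 0⟩

/-- The quaternion unit `j`. -/
def qJ : ℍ[ℝ] := ⟨0, 0, 1, 0⟩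

/-- The quaternion unit `k`. -/
def qK : ℍ[ℝ] := ⟨0, 0, 0, 1⟩

@[simp] theorem qI_re : qI.re = 0 := rfl
@[simp] theorem qI_imI : qI.imI = 1 := rfl
@[simp] theorem qI_imJ : qI.imJ = 0 := rfl
@[simp] theorem qI_imK : qI.imK = 0 := rfl
@[simp] theorem qJ_re : qJ.re = 0 := rfl
@[simp] theorem qJ_imI : qJ.imI = 0 := rfl
@[simp] theorem qJ_imJ : qJ.imJ = 1 := rfl
@[simp] theorem qJ_imK : qJ.imK = 0 := rfl
@[simp] theorem qK_re : qK.re = 0 := rfl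
@[simp] theorem qK_imI : qK.imI = 0 := rfl
@[simp] theorem qK_imJ : qK.imJ = 0 := rfl
@[simp] theorem qK_imK : qK.imK = 1 := rfl

@[simp] theorem star_qI : star qI = -qI := by ext <;> simp
@[simp] theorem star_qJ : star qJ = -qJ := by ext <;> simp
@[simp] theorem star_qK : star qK = -qK := by ext <;> simp
@[simp] theorem qI_mul_qI : qI * qI = -1 := by ext <;> simp
@[simp] theorem qJ_mul_qJ : qJ * qJ = -1 := by ext <;> simp
@[simp] theorem qK_mul_qK : qK * qK = -1 := by ext <;> simp
@[simp] theorem qI_mul_qJ : qI * qJ = qK := by ext <;> simp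
@[simp] theorem qJ_mul_qK : qJ * qK = qI := by ext <;> simp
@[simp] theorem qK_mul_qI : qK * qI = qJ := by ext <;> simp
@[simp] theorem qJ_mul_qI : qJ * qI = -qK := by ext <;> simp
@[simp] theorem qK_mul_qJ : qK * qJ = -qI := by ext <;> simp
@[simp] theorem qI_mul_qK : qI * qK = -qJ := by ext <;> simp

/-- Left multiplications by the units `i` and `j` anticommute, so they commute only on `0`. -/
theorem eq_zero_of_left_commute {a : Octonion}
    (h : conj (mk qI 0) * (conj (mk qJ 0) * a) = conj (mk qJ 0) * (conj (mk qI 0) * a)) :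
    a = 0 := by
  have h1 := congrArg fst h
  have h2 := congrArg snd h
  simp [Quaternion.ext_iff, mul_fst, mul_snd, conj_mk] at h1 h2
  apply Octonion.ext <;> ext <;> simp <;> linarith

theorem eq_zero_of_right_commute {a : Octonion}
    (h : (a * conj (mk qI 0)) * conj (mk qJ 0) = (a * conj (mk qJ 0)) * conj (mk qI 0)) :
    a = 0 := by
  have h1 := congrArg fst h
  have h2 := congrArg snd h
  simp [Quaternion.ext_iff, mul_fst, mul_snd, conj_mk] at h1 h2
  apply Octonion.ext <;> ext <;> simp <;> linarith

theorem eq_zero_of_conj_mul_symm {A : Octonion →ₗ[ℝ] Octonion}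
    (h : ∀ u v, conj v * A u = conj u * A v) : A = 0 := by
  have hA (u : Octonion) : A u = conj u * A 1 := by
    rw [← h u 1, conj_one, one_mul]
  have h1 : A 1 = 0 := eq_zero_of_left_commute <| by
    rw [← hA, ← hA, h]
  ext1 u
  rw [hA, h1, mul_zero, LinearMap.zero_apply]

theorem eq_zero_of_mul_conj_symm {B : Octonion →ₗ[ℝ] Octonion}
    (h : ∀ u v, B u * conj v = B v * conj u) : B = 0 := by
  have hB (u : Octonion) : B u = B 1 * conj u := by
    rw [← h u 1, conj_one, mul_one]
  have h1 : B 1 = 0 := eq_zero_of_right_commute <| by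
    rw [← hB, ← hB, h]
  ext1 u
  rw [hB, h1, zero_mul, LinearMap.zero_apply]

end Octonion

open Octonion

/-! ### The brackets -/

theorem doubleBracket_nondegenerate (x : Octonion × Octonion) (h : ∀ y, doubleBracket x y = 0) :
    x = 0 := by
  have h1 := h (0, 1)
  have h2 := h (1, 0)
  rw [doubleBracket_apply] at h1 h2
  simp only [mul_one, one_mul, zero_mul, mul_zero, sub_zero, zero_sub, neg_eq_zero] at h1 h2
  exact Prod.ext h1 h2

theorem heisBracket_nondegenerate (x : Octonion) (h : ∀ y, heisBracket x y = 0) : x = 0 := by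
  have key (y : Octonion) : x * conj y = re (x * conj y) • (1 : Octonion) := by
    have := congrArg Subtype.val (h y)
    rwa [heisBracket_apply, Submodule.coe_neg, Submodule.coe_zero, neg_eq_zero, coe_im,
      sub_eq_zero] at this
  have h1 := key 1
  have h2 := congrArg fst (key (mk qI 0))
  rw [conj_one, mul_one] at h1
  have h3 := congrArg fst h1
  simp [Quaternion.ext_iff, mul_fst, conj_mk] at h2 h3
  refine Octonion.ext (by ext <;> simp <;> linarith) ?_
  rw [h1, smul_snd, one_snd, smul_zero, zero_snd]

/-- The real parts drop out of the cyclic identity, since `T` takes imaginary values. -/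
theorem heisBracket_cyclicIdentity {T : Octonion →ₗ[ℝ] Im}
    (h : CyclicIdentity heisBracket (Octonion.metric.restrict Im) T) (u v w : Octonion) :
    form (T u) (v * conj w) + form (T v) (w * conj u) + form (T w) (u * conj v) = 0 := by
  have key (a b c : Octonion) : (Octonion.metric.restrict Im).form (T a) (heisBracket b c) =
      -form (T a) (b * conj c) := by
    change form (T a) (heisBracket b c : Octonion) = _
    have h1 : form (T a) 1 = 0 := by
      rw [form_apply, conj_one, mul_one]
      exact (T a).2
    rw [heisBracket_apply, Submodule.coe_neg, coe_im, map_neg, map_sub, map_smul, h1, smul_zero,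
      sub_zero]
  have := h u v w
  rw [key, key, key] at this
  linarith

/-! ### Fano plane systems -/

namespace Octonion

/-- The imaginary units, numbered along a Singer cycle of the Fano plane: the product of
`imUnit i` and `imUnit (i + 1)` is `± imUnit (i + 3)`, indices modulo 7. -/
def imUnit : Fin 7 → Octonion :=
  ![mk qI 0, mk qJ 0, mk 0 1, mk qK 0, mk 0 qJ, mk 0 qK, mk 0 qI]

theorem eq_sum_imUnit (x : Octonion) : x = x.1.re • (1 : Octonion) + x.1.imI • imUnit 0 +
    x.1.imJ • imUnit 1 + x.1.imK • imUnit 3 + x.2.re • imUnit 2 + x.2.imI • imUnit 6 +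
    x.2.imJ • imUnit 4 + x.2.imK • imUnit 5 := by
  apply Octonion.ext <;> ext <;> simp [imUnit]

theorem linearMap_eq_zero {f : Octonion →ₗ[ℝ] ℝ} (h1 : f 1 = 0) (h : ∀ i, f (imUnit i) = 0) :
    f = 0 := by
  ext1 x
  rw [eq_sum_imUnit x]
  simp [h1, h]

theorem imUnit_mul_conj_mul (i : Fin 7) (x : Octonion) :
    imUnit i * (conj (imUnit i) * x) = x := by
  fin_cases i <;> apply Octonion.ext <;> ext <;>
    simp [imUnit, mul_fst, mul_snd, conj_mk]

/-- The incidence matrix of the Fano plane is invertible over `ℝ`; the lines are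
`{i, i + 1, i + 3}` modulo 7. -/
theorem fano_eq_zero {x : Fin 7 → ℝ} (h : ∀ i, x i + x (i + 1) + x (i + 3) = 0) : x = 0 := by
  have h0 := h 0
  have h1 := h 1
  have h2 := h 2
  have h3 := h 3
  have h4 := h 4
  have h5 := h 5
  have h6 := h 6
  simp only [Fin.reduceAdd, zero_add] at h0 h1 h2 h3 h4 h5 h6
  ext i
  fin_cases i <;> simp <;> linarith

/-- On a line `{i, i + 1, i + 3}` the products `(e_b U) conj(e_c U)` are `± e_a`, with one sign for
the three cyclic rotations; here `U = 1`. -/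
theorem fano_one {p q r : Octonion} (i : Fin 7)
    (h : form p ((imUnit (i + 1) * mk 1 0) * conj (imUnit (i + 3) * mk 1 0)) +
      form q ((imUnit (i + 3) * mk 1 0) * conj (imUnit i * mk 1 0)) +
      form r ((imUnit i * mk 1 0) * conj (imUnit (i + 1) * mk 1 0)) = 0) :
    form p (imUnit i) + form q (imUnit (i + 1)) + form r (imUnit (i + 3)) = 0 := by
  fin_cases i <;> simp [imUnit, mk_mul_mk, conj_mk, form_eq] at h ⊢ <;> linarith

/-- The analogue of `fano_one` for `U` an imaginary unit: the sign now depends on the line and on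
`U`, but is still the same for the three cyclic rotations. -/
theorem fano_imUnit {p q r : Octonion} (i j : Fin 7)
    (h : form p ((imUnit (i + 1) * imUnit j) * conj (imUnit (i + 3) * imUnit j)) +
      form q ((imUnit (i + 3) * imUnit j) * conj (imUnit i * imUnit j)) +
      form r ((imUnit i * imUnit j) * conj (imUnit (i + 1) * imUnit j)) = 0) :
    form p (imUnit i) + form q (imUnit (i + 1)) + form r (imUnit (i + 3)) = 0 := by
  fin_cases j <;> fin_cases i <;> simp [imUnit, mk_mul_mk, conj_mk, form_eq] at h ⊢ <;> linarith

/-- For `x` a basis octonion, the numbers `⟨T (eᵢ x), eᵢ⟩` solve the Fano system, so they vanish;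
the case of general `x` follows by linearity. -/
theorem form_apply_imUnit_mul_eq_zero {T : Octonion →ₗ[ℝ] Octonion}
    (h : ∀ u v w, form (T u) (v * conj w) + form (T v) (w * conj u) + form (T w) (u * conj v) = 0)
    (x : Octonion) (i : Fin 7) : form (T (imUnit i * x)) (imUnit i) = 0 := by
  have key : (form.flip (imUnit i)) ∘ₗ T ∘ₗ (mulBilin (imUnit i)) = 0 := by
    refine linearMap_eq_zero ?_ fun j => ?_
    · have := fano_eq_zero (x := fun i => form (T (imUnit i * 1)) (imUnit i))
        fun i => fano_one i (h _ _ _)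
      exact congrFun this i
    · have := fano_eq_zero (x := fun i => form (T (imUnit i * imUnit j)) (imUnit i))
        fun i => fano_imUnit i j (h _ _ _)
      exact congrFun this i
  exact LinearMap.congr_fun key x

end Octonion

/-! ### The cyclic identity has no nonzero solution -/

theorem heisBracket_eq_zero_of_cyclicIdentity {T : Octonion →ₗ[ℝ] Im}
    (h : CyclicIdentity heisBracket (Octonion.metric.restrict Im) T) : T = 0 := by
  ext1 x
  have h1 : form (T x) = 0 := by
    refine linearMap_eq_zero ?_ fun i => ?_
    · rw [form_apply, conj_one, mul_one]
      exact (T x).2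
    · have := form_apply_imUnit_mul_eq_zero (T := Im.subtype ∘ₗ T) (heisBracket_cyclicIdentity h)
        (conj (imUnit i) * x) i
      rwa [imUnit_mul_conj_mul] at this
  exact Subtype.ext (Octonion.metric.eq_zero_of_forall_form_eq_zero (LinearMap.congr_fun h1))

theorem doubleBracket_eq_zero_of_cyclicIdentity {T : Octonion × Octonion →ₗ[ℝ] Octonion}
    (h : CyclicIdentity doubleBracket Octonion.metric T) : T = 0 := by
  apply LinearMap.prod_ext
  · rw [LinearMap.zero_comp]
    refine eq_zero_of_conj_mul_symm fun u v => ?_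
    rw [← sub_eq_zero]
    refine Octonion.metric.eq_zero_of_forall_form_eq_zero fun w => ?_
    have := h (u, 0) (v, 0) (0, w)
    change form (T (u, 0)) _ + form (T (v, 0)) _ + form (T (0, w)) _ = 0 at this
    simp only [doubleBracket_apply, mul_zero, sub_zero, zero_sub, map_neg, map_zero, add_zero,
      form_mul_right] at this
    change form (conj v * T (u, 0) - conj u * T (v, 0)) w = 0
    rw [map_sub, LinearMap.sub_apply]
    linarith
  · rw [LinearMap.zero_comp]
    refine eq_zero_of_mul_conj_symm fun u v => ?_
    rw [← sub_eq_zero]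
    refine Octonion.metric.eq_zero_of_forall_form_eq_zero fun w => ?_
    have := h (0, u) (0, v) (w, 0)
    change form (T (0, u)) _ + form (T (0, v)) _ + form (T (w, 0)) _ = 0 at this
    simp only [doubleBracket_apply, mul_zero, zero_mul, sub_zero, zero_sub, map_neg, map_zero,
      add_zero, form_mul_left] at this
    change form (T (0, u) * conj v - T (0, v) * conj u) w = 0
    rw [map_sub, LinearMap.sub_apply]
    linarith

end HTypeForce

end

theorem proposition4p3 :
    ((∀ F : HTypeForce.OctHeis →ₗ[ℝ] HTypeForce.OctHeis,
        HTypeForce.IsClosedLorentzForce HTypeForce.OctHeis.metric F →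
          HTypeForce.IsTypeI HTypeForce.OctHeis.metric F) ∧
      (¬ ∃ F : HTypeForce.OctHeis →ₗ[ℝ] HTypeForce.OctHeis, F ≠ 0 ∧
        HTypeForce.IsSkew HTypeForce.OctHeis.metric F ∧
        HTypeForce.IsTypeII HTypeForce.OctHeis.metric F ∧
        HTypeForce.CondC2 HTypeForce.OctHeis.metric F)) ∧
    ((∀ F : HTypeForce.OctDouble →ₗ[ℝ] HTypeForce.OctDouble,
        HTypeForce.IsClosedLorentzForce HTypeForce.OctDouble.metric F →
          HTypeForce.IsTypeI HTypeForce.OctDouble.metric F) ∧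
      (¬ ∃ F : HTypeForce.OctDouble →ₗ[ℝ] HTypeForce.OctDouble, F ≠ 0 ∧
        HTypeForce.IsSkew HTypeForce.OctDouble.metric F ∧
        HTypeForce.IsTypeII HTypeForce.OctDouble.metric F ∧
        HTypeForce.CondC2 HTypeForce.OctDouble.metric F)) := by
  refine ⟨⟨fun F hF => ?_, ?_⟩, fun F hF => ?_, ?_⟩
  · exact HTypeForce.isTypeI_of_isClosedLorentzForce HTypeForce.heisBracket_nondegenerate
      (fun T => HTypeForce.heisBracket_eq_zero_of_cyclicIdentity) hF
  · rintro ⟨F, hne, hF, hII, hC⟩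
    exact hne (HTypeForce.eq_zero_of_isTypeII_of_condC2 HTypeForce.heisBracket_nondegenerate
      (fun T => HTypeForce.heisBracket_eq_zero_of_cyclicIdentity) hF hII hC)
  · exact HTypeForce.isTypeI_of_isClosedLorentzForce HTypeForce.doubleBracket_nondegenerate
      (fun T => HTypeForce.doubleBracket_eq_zero_of_cyclicIdentity) hF
  · rintro ⟨F, hne, hF, hII, hC⟩
    exact hne (HTypeForce.eq_zero_of_isTypeII_of_condC2 HTypeForce.doubleBracket_nondegenerate
      (fun T => HTypeForce.doubleBracket_eq_zero_of_cyclicIdentity) hF hII hC)
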